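/- **Conventions.** Manifolds are smooth, Hausdorff, second countable and without boundary. A *(natural) polydifferential operator* of rank $\ell+1$ on $n$-manifolds is an assignment $D$ to each Riemannian $n$-manifold $(M,g)$ of a linear operator $D^g\colon C^\infty(M)^{\otimes \ell}\to C^\infty(M)$ such that $D^g(u_1\otimes\dots\otimes u_\ell)$ is a linear combination, with finitely many terms and real coefficients independent of $(M,g)$, of complete contractions (with the inverse metric) of tensors $\nabla^{N_1}\mathrm{Rm}\otimes\dots\otimes\nabla^{N_p}\mathrm{Rm}\otimes\nabla^{N_{p+1}}u_1\otimes\dots\otimes\nabla^{N_{p+\ell}}u_\ell$. It is *symmetric* if $D^g(u_{\sigma(1)}\otimes\dots\otimes u_{\sigma(\ell)})=D^g(u_1\otimes\dots\otimes u_\ell)$ for all permutations $\sigma$. It is *conformally covariant* if there are $a_1,\dots,a_\ell,b\in\mathbb R$ with $D^{e^{2\Upsilon}g}(u_1\otimes\dots\otimes u_\ell)=e^{b\Upsilon}D^g(e^{-a_1\Upsilon}u_1\otimes\dots\otimes e^{-a_\ell\Upsilon}u_\ell)$ for all $(M,g)$ and all $\Upsilon,u_j\in C^\infty(M)$. A *formally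 self-adjoint, conformally covariant, polydifferential operator* of rank $r\ge 1$ and homogeneity $-2k$ (with $k\in\{0,1,2,\dots\}$) is a polydifferential operator $D$ of rank $r$ such that $D^{c^2g}=c^{-2k}D^g$ for all $(M,g)$ and all constants $c>0$, whose Dirichlet form $\mathfrak D^g(u_1\otimes\dots\otimes u_r)=\int_M u_1D^g(u_2\otimes\dots\otimes u_r)\,\mathrm{dvol}_g$ on compactly supported smooth functions is symmetric in $u_1,\dots,u_r$, and for which there is $w_0\in\mathbb R$ with $\mathfrak D^{e^{2\Upsilon}g}(e^{w_0\Upsilon}u_1\otimes\dots\otimes e^{w_0\Upsilon}u_r)=\mathfrak D^g(u_1\otimes\dots\otimes u_r)$ for all $(M,g)$, all $\Upsilon\in C^\infty(M)$ and all compactly supported smooth $u_j$. A *constrained polydifferential operator* of rank $r$ and homogeneity $-2k$ on $n$-manifolds is a pair $(D,\mathscr C)$ of such a $D$ and a finite (possibly empty) set $\mathscr C$ of symmetric conformally covariant polydifferential operators (of possibly different ranks $r(C)$) such that for each $C\in\mathscr C$ there is $b(C)\in\mathbb R$ with $$C^{e^{2\Upsilon}g}\bigl(u^{\otimes(r(C)-1)}\bigr)=e^{b(C)\Upsilon}C^g\Bigl(\bigl(e^{\frac{n-2k}{r}\Upsilon}u\bigr)^{\otimes(r(C)-1)}\Bigr)$$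 for all Riemannian $n$-manifolds $(M,g)$ and all $\Upsilon,u\in C^\infty(M)$. Its *constrained cone* is $U_{\mathscr C}^g=\{u\in C^\infty(M): C^g(u^{\otimes(r(C)-1)})>0 \text{ on } M \text{ for all } C\in\mathscr C\}$. For a Riemannian $n$-manifold $(M,g)$ with conformal class $\mathfrak c=\{e^{2\Upsilon}g:\Upsilon\in C^\infty(M)\}$, let $\mathrm{Conf}(M,\mathfrak c)$ be the group, under composition, of diffeomorphisms $\Phi$ of $M$ with $\Phi^*g\in\mathfrak c$, and define $|J_\Phi|$ by $\mathrm{dvol}_{\Phi^*g}=|J_\Phi|\,\mathrm{dvol}_g$. **Lemma.** Let $(D,\mathscr C)$ be a constrained polydifferential operator of rank $r$ and homogeneity $-2k>-n$ on $n$-manifolds. Fix a Riemannian $n$-manifold $(M,g)$ and set $w:=-(n-2k)/r$. Then $$u\cdot\Phi:=|J_\Phi|^{-w/n}\,\Phi^*u$$ defines a right action of $\mathrm{Conf}(M,\mathfrak c)$ on $C^\infty(M)$, and $U_{\mathscr C}^g$ is invariant under this action. Moreover, for every $\lambda\in\mathbb R$ and $\Phi\in\mathrm{Conf}(M,\mathfrak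 c)$, if $u\in U_{\mathscr C}^g$ solves $$D^g\bigl(u^{\otimes(r-1)}\bigr)=\Bigl(\frac{n-2k}{r}\Bigr)^{r-1}\lambda\,|u|^{\frac{(r-2)n+4k}{n-2k}}u$$ (the right-hand side being $0$ where $u=0$), then $u\cdot\Phi$ solves the same equation with the same $\lambda$. -/

import Mathlib

open Set Filter Topology MeasureTheory
open scoped Manifold ContDiff

universe u

noncomputable section

/-! Riemannian metrics -/

/-- The model space `ℝⁿ`. -/
abbrev RSpace (n : ℕ) : Type := EuclideanSpace ℝ (Fin n)

/-- The algebra `C^∞(M)` of real valued smooth functions. -/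
abbrev SmoothFun (n : ℕ) (M : Type u) [TopologicalSpace M] [ChartedSpace (RSpace n) M] : Type u :=
  ContMDiffMap (𝓡 n) 𝓘(ℝ, ℝ) M ℝ ∞

/-- Smooth Riemannian metrics on the smooth `n`-manifold `M` (Mathlib's notion). -/
abbrev SmoothMetric (n : ℕ) (M : Type u) [TopologicalSpace M] [ChartedSpace (RSpace n) M]
    [IsManifold (𝓡 n) ∞ M] : Type u :=
  Bundle.ContMDiffRiemannianMetric (𝓡 n) ∞ (RSpace n) (fun x : M => TangentSpace (𝓡 n) x)

/-- Fields of bilinear forms on the tangent spaces. -/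
abbrev BilinField (n : ℕ) (M : Type u) [TopologicalSpace M] [ChartedSpace (RSpace n) M] : Type u :=
  ∀ x : M, TangentSpace (𝓡 n) x →L[ℝ] TangentSpace (𝓡 n) x →L[ℝ] ℝ

/-- `ĝ = e^{2Υ} g`. -/
def IsConformalChange {n : ℕ} {M : Type u} [TopologicalSpace M] [ChartedSpace (RSpace n) M]
    (Υ : SmoothFun n M) (g ghat : BilinField n M) : Prop :=
  ∀ (x : M) (v w : TangentSpace (𝓡 n) x), ghat x v w = Real.exp (2 * Υ x) * g x v w

/-- The pullback `Φ^* g`, that is `(Φ^* g)_x(v, w) = g_{Φ x}(dΦ v, dΦ w)`. -/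
def pullbackForm {n : ℕ} {M : Type u} [TopologicalSpace M] [ChartedSpace (RSpace n) M]
    (Φ : M → M) (g : BilinField n M) : BilinField n M := fun x =>
  ContinuousLinearMap.bilinearComp (show RSpace n →L[ℝ] RSpace n →L[ℝ] ℝ from g (Φ x))
    (show RSpace n →L[ℝ] RSpace n from mfderiv (𝓡 n) (𝓡 n) Φ x)
    (show RSpace n →L[ℝ] RSpace n from mfderiv (𝓡 n) (𝓡 n) Φ x)

theorem pullbackForm_apply {n : ℕ} {M : Type u} [TopologicalSpace M] [ChartedSpace (RSpace n) M]
    (Φ : M → M) (g : BilinField n M) (x : M) (v w : TangentSpace (𝓡 n) x) :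
    pullbackForm Φ g x v w =
      g (Φ x) (mfderiv (𝓡 n) (𝓡 n) Φ x v) (mfderiv (𝓡 n) (𝓡 n) Φ x w) := rfl

/-- The coefficients `g_{ij}` of a field of bilinear forms in the chart `φ`, as functions on the
target of `φ`: the values of the form on the coordinate vector fields `∂_i`, `∂_j`. -/
def coordGram {n : ℕ} {M : Type u} [TopologicalSpace M] [ChartedSpace (RSpace n) M]
    (g : BilinField n M) (φ : OpenPartialHomeomorph M (RSpace n)) (y : RSpace n) :
    Matrix (Fin n) (Fin n) ℝ := fun i j =>
  g (φ.symm y)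
    (mfderiv 𝓘(ℝ, RSpace n) (𝓡 n) φ.symm y (EuclideanSpace.single i (1 : ℝ)))
    (mfderiv 𝓘(ℝ, RSpace n) (𝓡 n) φ.symm y (EuclideanSpace.single j (1 : ℝ)))

/-! Tensor calculus in coordinates. Here `G` is the matrix `g_{ij}` of a Riemannian metric on an
open subset of `ℝⁿ`. -/

/-- The components of a covariant tensor of rank `m` in coordinates. -/
abbrev CoordTensor (n m : ℕ) : Type := (Fin m → Fin n) → RSpace n → ℝ

/-- The partial derivative `∂_i f`. -/
def partialD {n : ℕ} (i : Fin n) (f : RSpace n → ℝ) (y : RSpace n) : ℝ :=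
  fderiv ℝ f y (EuclideanSpace.single i (1 : ℝ))

/-- The Christoffel symbols
`Γ^k_{ij} = ½ g^{kl} (∂_i g_{jl} + ∂_j g_{il} - ∂_l g_{ij})` of the Levi-Civita connection. -/
def christoffel {n : ℕ} (G : RSpace n → Matrix (Fin n) (Fin n) ℝ) (k i j : Fin n)
    (y : RSpace n) : ℝ :=
  (1 / 2 : ℝ) * ∑ l, (G y)⁻¹ k l *
    (partialD i (fun z => G z j l) y + partialD j (fun z => G z i l) y
      - partialD l (fun z => G z i j) y)

/-- The components `R^d_{abc}` of the curvature, where `R(∂_a, ∂_b) ∂_c = R^d_{abc} ∂_d` and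
`R(X, Y) Z = ∇_X ∇_Y Z - ∇_Y ∇_X Z - ∇_{[X, Y]} Z`. -/
def curvatureUp {n : ℕ} (G : RSpace n → Matrix (Fin n) (Fin n) ℝ) (d a b c : Fin n)
    (y : RSpace n) : ℝ :=
  partialD a (christoffel G d b c) y - partialD b (christoffel G d a c) y
    + ∑ e, (christoffel G d a e y * christoffel G e b c y
      - christoffel G d b e y * christoffel G e a c y)

/-- The Riemann curvature tensor `Rm(∂_a, ∂_b, ∂_c, ∂_d) = g(R(∂_a, ∂_b) ∂_c, ∂_d)`. -/
def riemannTensor {n : ℕ} (G : RSpace n → Matrix (Fin n) (Fin n) ℝ) : CoordTensor n 4 :=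
  fun a y => ∑ d, G y d (a 3) * curvatureUp G d (a 0) (a 1) (a 2) y

/-- The covariant derivative of a covariant tensor; the new index is the first one:
`(∇T)_{b a_1 … a_m} = ∂_b T_{a_1 … a_m} - ∑_s Γ^k_{b a_s} T_{a_1 … k … a_m}`. -/
def covDeriv {n m : ℕ} (G : RSpace n → Matrix (Fin n) (Fin n) ℝ) (T : CoordTensor n m) :
    CoordTensor n (m + 1) := fun a y =>
  partialD (a 0) (T (Fin.tail a)) y
    - ∑ s : Fin m, ∑ k : Fin n,
        christoffel G k (a 0) (Fin.tail a s) y * T (Function.update (Fin.tail a) s k) y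

/-- The iterated covariant derivative `∇^N T`. -/
def iterCovDeriv {n m : ℕ} (G : RSpace n → Matrix (Fin n) (Fin n) ℝ) (T : CoordTensor n m) :
    ∀ N : ℕ, CoordTensor n (m + N)
  | 0 => T
  | N + 1 => covDeriv G (iterCovDeriv G T N)

/-! Natural polydifferential operators -/

/-- A complete contraction of
`∇^{N_1} Rm ⊗ ⋯ ⊗ ∇^{N_p} Rm ⊗ ∇^{N'_1} u_1 ⊗ ⋯ ⊗ ∇^{N'_ℓ} u_ℓ`: the powers, and a
perfect matching of the index slots, given by listing the pairs of slots to be contracted. -/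
structure CompleteContraction (ℓ : ℕ) where
  /-- the number of curvature factors -/
  numCurv : ℕ
  /-- the powers `N_i` -/
  curvOrder : Fin numCurv → ℕ
  /-- the powers `N'_j` -/
  funOrder : Fin ℓ → ℕ
  /-- the number of contracted pairs -/
  numPairs : ℕ
  /-- the two slots of each pair -/
  pairing : (Fin numPairs ⊕ Fin numPairs) ≃
    ((Σ i : Fin numCurv, Fin (4 + curvOrder i)) ⊕ (Σ j : Fin ℓ, Fin (0 + funOrder j)))

/-- The value at `y` of a complete contraction (the pairs are contracted with the inverse metric)
for the metric and the functions with coordinate expressions `G` and `u_1, …, u_ℓ`. -/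
def CompleteContraction.eval {n ℓ : ℕ} (K : CompleteContraction ℓ)
    (G : RSpace n → Matrix (Fin n) (Fin n) ℝ) (u : Fin ℓ → RSpace n → ℝ) (y : RSpace n) : ℝ :=
  ∑ a : ((Σ i : Fin K.numCurv, Fin (4 + K.curvOrder i)) ⊕
      (Σ j : Fin ℓ, Fin (0 + K.funOrder j))) → Fin n,
    (∏ p : Fin K.numPairs, (G y)⁻¹ (a (K.pairing (Sum.inl p))) (a (K.pairing (Sum.inr p)))) *
    (∏ i, iterCovDeriv G (riemannTensor G) (K.curvOrder i) (fun s => a (Sum.inl ⟨i, s⟩)) y) *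
    (∏ j, iterCovDeriv G (fun _ : Fin 0 → Fin n => u j) (K.funOrder j)
      (fun s => a (Sum.inr ⟨j, s⟩)) y)

/-- A (natural) polydifferential operator of rank `ℓ + 1` on `n`-manifolds: an assignment to each
Riemannian `n`-manifold `(M, g)` of a linear operator `C^∞(M)^{⊗ℓ} → C^∞(M)`, i.e. of an
`ℓ`-linear operator, that is given by a universal linear combination of complete contractions:
the coefficients (and patterns) are the same for all `(M, g)`. A complete contraction is evaluated
through components in a chart, and the components may be taken in any smooth chart. -/
structure PolyDiffOp (n ℓ : ℕ) where
  /-- the operator of `(M, g)` -/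
  op : ∀ (M : Type u) [TopologicalSpace M] [ChartedSpace (RSpace n) M] [IsManifold (𝓡 n) ∞ M]
    [T2Space M] [SecondCountableTopology M] (_ : SmoothMetric n M),
    MultilinearMap ℝ (fun _ : Fin ℓ => SmoothFun n M) (SmoothFun n M)
  natural : ∃ c : CompleteContraction ℓ →₀ ℝ,
    ∀ (M : Type u) [TopologicalSpace M] [ChartedSpace (RSpace n) M] [IsManifold (𝓡 n) ∞ M]
      [T2Space M] [SecondCountableTopology M] (g : SmoothMetric n M)
      (v : Fin ℓ → SmoothFun n M),
      ∀ φ ∈ IsManifold.maximalAtlas (𝓡 n) ∞ M, ∀ y ∈ φ.target,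
        op M g v (φ.symm y) =
          c.sum fun K t => t * K.eval (coordGram g.inner φ) (fun j z => v j (φ.symm z)) y

/-- The smooth function `e^{aΥ} v`. -/
def expMul {n : ℕ} {M : Type u} [TopologicalSpace M] [ChartedSpace (RSpace n) M]
    (a : ℝ) (Υ v : SmoothFun n M) : SmoothFun n M :=
  ⟨fun x => Real.exp (a * Υ x) * v x,
    (Real.contDiff_exp.contMDiff.comp (contMDiff_const.mul Υ.contMDiff)).mul v.contMDiff⟩

/-! The Riemannian volume -/

/-- A smooth partition of unity on `M`, indexed by the points of `M`, whose `x`-th member is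
supported in the domain of the preferred chart at `x`. -/
def chartPartition (n : ℕ) (M : Type u) [TopologicalSpace M] [ChartedSpace (RSpace n) M]
    [IsManifold (𝓡 n) ∞ M] [T2Space M] [SecondCountableTopology M] :
    SmoothPartitionOfUnity M (𝓡 n) M univ :=
  haveI : LocallyCompactSpace M := ChartedSpace.locallyCompactSpace (RSpace n) M
  (SmoothPartitionOfUnity.exists_isSubordinate_chartAt_source (𝓡 n) M).choose

/-- The integral `∫_M f dvol_g` of a compactly supported continuous function: the sum over a
partition of unity `ρ` subordinate to the charts of `∫ ρ_x f √(det g_{ij}) dy`. -/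
def volIntegral {n : ℕ} {M : Type u} [TopologicalSpace M] [ChartedSpace (RSpace n) M]
    [IsManifold (𝓡 n) ∞ M] [T2Space M] [SecondCountableTopology M]
    (g : BilinField n M) (f : M → ℝ) : ℝ :=
  ∑ᶠ x : M, ∫ y in (chartAt (RSpace n) x).target,
    chartPartition n M x ((chartAt (RSpace n) x).symm y) * f ((chartAt (RSpace n) x).symm y) *
      Real.sqrt (coordGram g (chartAt (RSpace n) x) y).det

/-- The Gram matrix of the form `g_x` on the standard basis of `T_x M`
(identified with `ℝⁿ` through the preferred chart at `x`). -/
def gramAt {n : ℕ} {M : Type u} [TopologicalSpace M] [ChartedSpace (RSpace n) M]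
    (g : BilinField n M) (x : M) : Matrix (Fin n) (Fin n) ℝ := fun i j =>
  g x (show RSpace n from EuclideanSpace.single i (1 : ℝ))
    (show RSpace n from EuclideanSpace.single j (1 : ℝ))

/-- The Jacobian determinant `|J_Φ|` with respect to `g`, that is the ratio of the volume
densities of `Φ^* g` and `g` (computed in one and the same basis of `T_x M`), so that
`dvol_{Φ^* g} = |J_Φ| dvol_g`; see `volIntegral_pullback`. -/
def absJacobian {n : ℕ} {M : Type u} [TopologicalSpace M] [ChartedSpace (RSpace n) M]
    (g : BilinField n M) (Φ : M → M) (x : M) : ℝ :=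
  Real.sqrt (gramAt (pullbackForm Φ g) x).det / Real.sqrt (gramAt g x).det

/-! Formal self-adjointness and conformal covariance -/

namespace PolyDiffOp

variable {n ℓ : ℕ}

/-- The Dirichlet form `∫_M u_1 D^g(u_2 ⊗ ⋯ ⊗ u_r) dvol_g`, with `r = ℓ + 1`. -/
def dirichletForm (D : PolyDiffOp.{u} n ℓ) (M : Type u) [TopologicalSpace M]
    [ChartedSpace (RSpace n) M] [IsManifold (𝓡 n) ∞ M] [T2Space M] [SecondCountableTopology M]
    (g : SmoothMetric n M) (v : Fin (ℓ + 1) → SmoothFun n M) : ℝ :=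
  volIntegral g.inner (fun x => v 0 x * D.op M g (Fin.tail v) x)

/-- `D` has homogeneity `h`: `D^{c²g} = c^h D^g` for all constants `c > 0`. -/
def HasHomogeneity (D : PolyDiffOp.{u} n ℓ) (h : ℝ) : Prop :=
  ∀ (M : Type u) [TopologicalSpace M] [ChartedSpace (RSpace n) M] [IsManifold (𝓡 n) ∞ M]
    [T2Space M] [SecondCountableTopology M] (g ghat : SmoothMetric n M) (c : ℝ), 0 < c →
    (∀ (x : M) (v w : TangentSpace (𝓡 n) x), ghat.inner x v w = c ^ 2 * g.inner x v w) →
    D.op M ghat = c ^ h • D.op M g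

/-- `D` is formally self-adjoint: its Dirichlet form on compactly supported smooth functions is
symmetric. -/
def IsFormallySelfAdjoint (D : PolyDiffOp.{u} n ℓ) : Prop :=
  ∀ (M : Type u) [TopologicalSpace M] [ChartedSpace (RSpace n) M] [IsManifold (𝓡 n) ∞ M]
    [T2Space M] [SecondCountableTopology M] (g : SmoothMetric n M)
    (v : Fin (ℓ + 1) → SmoothFun n M), (∀ j, HasCompactSupport (v j)) →
    ∀ σ : Equiv.Perm (Fin (ℓ + 1)),
      D.dirichletForm M g (fun j => v (σ j)) = D.dirichletForm M g v

/-- Conformal covariance of the Dirichlet form: for some weight `w`, if `ĝ = e^{2Υ} g`, then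
the Dirichlet form of `ĝ` at `e^{wΥ} u_1, …, e^{wΥ} u_r` is that of `g` at `u_1, …, u_r`. -/
def IsDirichletCovariant (D : PolyDiffOp.{u} n ℓ) : Prop :=
  ∃ w : ℝ, ∀ (M : Type u) [TopologicalSpace M] [ChartedSpace (RSpace n) M]
    [IsManifold (𝓡 n) ∞ M] [T2Space M] [SecondCountableTopology M] (g ghat : SmoothMetric n M)
    (Υ : SmoothFun n M), IsConformalChange Υ g.inner ghat.inner →
    ∀ v : Fin (ℓ + 1) → SmoothFun n M, (∀ j, HasCompactSupport (v j)) →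
      D.dirichletForm M ghat (fun j => expMul w Υ (v j)) = D.dirichletForm M g v

/-- `D` is symmetric. -/
def IsSymmetric (D : PolyDiffOp.{u} n ℓ) : Prop :=
  ∀ (M : Type u) [TopologicalSpace M] [ChartedSpace (RSpace n) M] [IsManifold (𝓡 n) ∞ M]
    [T2Space M] [SecondCountableTopology M] (g : SmoothMetric n M)
    (v : Fin ℓ → SmoothFun n M) (σ : Equiv.Perm (Fin ℓ)),
    D.op M g (fun j => v (σ j)) = D.op M g v

/-- `D` is conformally covariant: there are weights `a_1, …, a_ℓ, b` such that if `ĝ = e^{2Υ} g`,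
then `D^ĝ(u_1 ⊗ ⋯ ⊗ u_ℓ) = e^{bΥ} D^g(e^{-a_1 Υ} u_1 ⊗ ⋯ ⊗ e^{-a_ℓ Υ} u_ℓ)`. -/
def IsConformallyCovariant (D : PolyDiffOp.{u} n ℓ) : Prop :=
  ∃ (a : Fin ℓ → ℝ) (b : ℝ), ∀ (M : Type u) [TopologicalSpace M] [ChartedSpace (RSpace n) M]
    [IsManifold (𝓡 n) ∞ M] [T2Space M] [SecondCountableTopology M] (g ghat : SmoothMetric n M)
    (Υ : SmoothFun n M), IsConformalChange Υ g.inner ghat.inner →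
    ∀ v : Fin ℓ → SmoothFun n M,
      D.op M ghat v = expMul b Υ (D.op M g (fun j => expMul (-a j) Υ (v j)))

/-- The transformation law required of a constraint, with `s` in the role of `(n - 2k) / r`:
there is `b` such that `C^{e^{2Υ} g}(u ⊗ ⋯ ⊗ u) = e^{bΥ} C^g(e^{sΥ} u ⊗ ⋯ ⊗ e^{sΥ} u)`. -/
def IsConstraintOfWeight (C : PolyDiffOp.{u} n ℓ) (s : ℝ) : Prop :=
  ∃ b : ℝ, ∀ (M : Type u) [TopologicalSpace M] [ChartedSpace (RSpace n) M]
    [IsManifold (𝓡 n) ∞ M] [T2Space M] [SecondCountableTopology M] (g ghat : SmoothMetric n M)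
    (Υ : SmoothFun n M), IsConformalChange Υ g.inner ghat.inner →
    ∀ v : SmoothFun n M,
      C.op M ghat (fun _ => v) = expMul b Υ (C.op M g (fun _ => expMul s Υ v))

end PolyDiffOp

/-- A constrained polydifferential operator `(D, 𝒞)` of rank `r = ℓ + 1` and homogeneity `-2k` on
`n`-manifolds. The constraints may have different ranks. -/
structure ConstrainedOp (n ℓ k : ℕ) where
  /-- the operator `D` -/
  D : PolyDiffOp.{u} n ℓ
  homogeneity : D.HasHomogeneity (-2 * (k : ℝ))
  selfAdjoint : D.IsFormallySelfAdjoint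
  covariant : D.IsDirichletCovariant
  /-- the finite set `𝒞` of constraints -/
  constraints : Set (Σ m : ℕ, PolyDiffOp.{u} n m)
  finite : constraints.Finite
  constraint_symmetric : ∀ C ∈ constraints, C.2.IsSymmetric
  constraint_covariant : ∀ C ∈ constraints, C.2.IsConformallyCovariant
  constraint_weight : ∀ C ∈ constraints,
    C.2.IsConstraintOfWeight (((n : ℝ) - 2 * k) / ((ℓ : ℝ) + 1))

namespace ConstrainedOp

variable {n ℓ k : ℕ}

/-- The constrained cone `U_𝒞^g`: the smooth `v` with `C^g(v ⊗ ⋯ ⊗ v) > 0` for all `C ∈ 𝒞`. -/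
def cone (P : ConstrainedOp.{u} n ℓ k) {M : Type u} [TopologicalSpace M]
    [ChartedSpace (RSpace n) M] [IsManifold (𝓡 n) ∞ M] [T2Space M] [SecondCountableTopology M]
    (g : SmoothMetric n M) : Set (SmoothFun n M) :=
  {v | ∀ C ∈ P.constraints, ∀ x : M, 0 < C.2.op M g (fun _ => v) x}

/-- `v` solves the equation
`D^g(v ⊗ ⋯ ⊗ v) = ((n - 2k) / r)^{r-1} lam |v|^{((r - 2) n + 4k) / (n - 2k)} v`, `r = ℓ + 1`. -/
def Solves (P : ConstrainedOp.{u} n ℓ k) {M : Type u} [TopologicalSpace M]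
    [ChartedSpace (RSpace n) M] [IsManifold (𝓡 n) ∞ M] [T2Space M] [SecondCountableTopology M]
    (g : SmoothMetric n M) (lam : ℝ) (v : SmoothFun n M) : Prop :=
  ∀ x : M, P.D.op M g (fun _ => v) x =
    (((n : ℝ) - 2 * k) / ((ℓ : ℝ) + 1)) ^ ℓ * lam *
      |v x| ^ (((((ℓ : ℝ) + 1) - 2) * n + 4 * k) / ((n : ℝ) - 2 * k)) * v x

end ConstrainedOp

/-! The conformal group -/

theorem pullbackForm_comp {n : ℕ} {M : Type u} [TopologicalSpace M] [ChartedSpace (RSpace n) M]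
    {Φ Ψ : M → M} (hΦ : ContMDiff (𝓡 n) (𝓡 n) ∞ Φ) (hΨ : ContMDiff (𝓡 n) (𝓡 n) ∞ Ψ)
    (g : BilinField n M) : pullbackForm (Φ ∘ Ψ) g = pullbackForm Ψ (pullbackForm Φ g) := by
  funext x
  ext v w
  have h := mfderiv_comp x ((hΦ.mdifferentiable (by simp)) (Ψ x))
    ((hΨ.mdifferentiable (by simp)) x)
  rw [pullbackForm_apply, h]
  rfl

theorem pullbackForm_id {n : ℕ} {M : Type u} [TopologicalSpace M] [ChartedSpace (RSpace n) M]
    (g : BilinField n M) : pullbackForm id g = g := by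
  funext x
  ext v w
  rw [pullbackForm_apply, mfderiv_id]
  rfl

/-- The conformal group `Conf(M, 𝔠)` of the conformal class `𝔠` of `g`, under composition: the
diffeomorphisms `Φ` of `M` with `Φ^* g ∈ 𝔠`, i.e. `Φ^* g = e^{2Υ} g` for some smooth `Υ`. -/
def conformalGroup {n : ℕ} {M : Type u} [TopologicalSpace M] [ChartedSpace (RSpace n) M]
    [IsManifold (𝓡 n) ∞ M] (g : SmoothMetric n M) : Subgroup (Equiv.Perm M) where
  carrier := {Φ | ContMDiff (𝓡 n) (𝓡 n) ∞ Φ ∧ ContMDiff (𝓡 n) (𝓡 n) ∞ Φ.symm ∧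
    ∃ Υ : SmoothFun n M, IsConformalChange Υ g.inner (pullbackForm Φ g.inner)}
  one_mem' := by
    refine ⟨contMDiff_id, contMDiff_id, 0, fun x v w => ?_⟩
    have : pullbackForm (⇑(1 : Equiv.Perm M)) g.inner = g.inner := pullbackForm_id g.inner
    rw [this]
    simp
  mul_mem' := by
    rintro Φ Ψ ⟨hΦ, hΦ', A, hA⟩ ⟨hΨ, hΨ', B, hB⟩
    refine ⟨hΦ.comp hΨ, hΨ'.comp hΦ', A.comp ⟨Ψ, hΨ⟩ + B, fun x v w => ?_⟩
    have h : pullbackForm (⇑(Φ * Ψ)) g.inner = pullbackForm Ψ (pullbackForm Φ g.inner) :=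
      pullbackForm_comp hΦ hΨ g.inner
    rw [h]
    have h1 := hA (Ψ x) (mfderiv (𝓡 n) (𝓡 n) Ψ x v) (mfderiv (𝓡 n) (𝓡 n) Ψ x w)
    have h2 := hB x v w
    have h3 : pullbackForm Ψ (pullbackForm Φ g.inner) x v w =
      Real.exp (2 * A (Ψ x)) * pullbackForm Ψ g.inner x v w := h1
    rw [h3, h2, ← mul_assoc, ← Real.exp_add, ← mul_add]
    rfl
  inv_mem' := by
    rintro Φ ⟨hΦ, hΦ', A, hA⟩
    refine ⟨hΦ', hΦ, -(A.comp ⟨Φ.symm, hΦ'⟩), fun x v w => ?_⟩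
    have h : pullbackForm (⇑Φ.symm) (pullbackForm Φ g.inner) = g.inner := by
      rw [← pullbackForm_comp hΦ hΦ']
      have : (Φ ∘ Φ.symm : M → M) = id := by
        funext z
        simp
      rw [this, pullbackForm_id]
    have h1 : pullbackForm Φ.symm (pullbackForm Φ g.inner) x v w =
      Real.exp (2 * A (Φ.symm x)) * pullbackForm Φ.symm g.inner x v w :=
      hA (Φ.symm x) (mfderiv (𝓡 n) (𝓡 n) Φ.symm x v) (mfderiv (𝓡 n) (𝓡 n) Φ.symm x w)
    rw [h] at h1
    have h4 : (-(A.comp ⟨Φ.symm, hΦ'⟩) : SmoothFun n M) x = - A (Φ.symm x) := rfl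
    have h5 : pullbackForm (⇑Φ⁻¹) g.inner x v w = pullbackForm Φ.symm g.inner x v w := rfl
    rw [h5, h4, h1, ← mul_assoc, ← Real.exp_add]
    simp

/-! The Jacobian is the density of `dvol_{Φ^* g}` with respect to `dvol_g` -/

theorem coordGram_eq {n : ℕ} {M : Type u} [TopologicalSpace M] [ChartedSpace (RSpace n) M]
    (φ : OpenPartialHomeomorph M (RSpace n)) (y : RSpace n) :
    ∃ A : Matrix (Fin n) (Fin n) ℝ, ∀ g : BilinField n M,
      coordGram g φ y = A.transpose * gramAt g (φ.symm y) * A := by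
  let L : RSpace n →L[ℝ] RSpace n := mfderiv 𝓘(ℝ, RSpace n) (𝓡 n) φ.symm y
  refine ⟨fun a i => L (EuclideanSpace.single i (1 : ℝ)) a, fun g => ?_⟩
  let B : RSpace n →L[ℝ] RSpace n →L[ℝ] ℝ := g (φ.symm y)
  have hsum : ∀ v : RSpace n, v = ∑ a, v a • EuclideanSpace.single a (1 : ℝ) := by
    intro v
    ext b
    simp [Finset.sum_apply, Pi.single_apply]
  have key : ∀ v w : RSpace n, B v w = ∑ b, (∑ a, v a * B (EuclideanSpace.single a (1 : ℝ))
      (EuclideanSpace.single b (1 : ℝ))) * w b := by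
    intro v w
    conv_lhs => rw [hsum v, hsum w]
    simp only [map_sum, map_smul, _root_.sum_apply, _root_.smul_apply,
      smul_eq_mul, Finset.mul_sum, Finset.sum_mul]
    refine Finset.sum_congr rfl fun b _ => Finset.sum_congr rfl fun a _ => ?_
    ring
  ext i j
  exact key _ _

theorem gramAt_det_pos {n : ℕ} {M : Type u} [TopologicalSpace M] [ChartedSpace (RSpace n) M]
    [IsManifold (𝓡 n) ∞ M] (g : SmoothMetric n M) (x : M) : 0 < (gramAt g.inner x).det := by
  let B : RSpace n →L[ℝ] RSpace n →L[ℝ] ℝ := g.inner x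
  have hB : ∀ v w, B v w = B w v := g.symm x
  have hpos : ∀ v, v ≠ 0 → 0 < B v v := g.pos x
  refine Matrix.PosDef.det_pos (Matrix.PosDef.of_dotProduct_mulVec_pos ?_ ?_)
  · ext i j
    exact hB _ _
  · intro v hv
    have h := hpos (∑ a, v a • EuclideanSpace.single a (1 : ℝ)) (by
      intro h0
      apply hv
      funext b
      have := congrArg (fun z : RSpace n => z b) h0
      simpa [Finset.sum_apply, Pi.single_apply] using this)
    have e : B (∑ a, v a • EuclideanSpace.single a (1 : ℝ))
        (∑ a, v a • EuclideanSpace.single a (1 : ℝ)) =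
        star v ⬝ᵥ ((gramAt g.inner x).mulVec v) := by
      simp only [map_sum, map_smul, _root_.sum_apply,
        _root_.smul_apply, smul_eq_mul, Finset.mul_sum, dotProduct, Matrix.mulVec]
      rw [Finset.sum_comm]
      refine Finset.sum_congr rfl fun b _ => Finset.sum_congr rfl fun a _ => ?_
      simp only [star_trivial, gramAt]
      change v a * (v b * B _ _) = v b * (B _ _ * v a)
      ring
    rwa [e] at h

/-- `dvol_{Φ^* g} = |J_Φ| dvol_g`. -/
theorem volIntegral_pullback {n : ℕ} {M : Type u} [TopologicalSpace M]
    [ChartedSpace (RSpace n) M] [IsManifold (𝓡 n) ∞ M] [T2Space M] [SecondCountableTopology M]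
    (g : SmoothMetric n M) (Φ : M → M) (f : M → ℝ) :
    volIntegral (pullbackForm Φ g.inner) f =
      volIntegral g.inner (fun x => absJacobian g.inner Φ x * f x) := by
  unfold volIntegral
  refine finsum_congr fun x => ?_
  congr 1
  funext y
  obtain ⟨A, hA⟩ := coordGram_eq (chartAt (RSpace n) x) y
  have hd : ∀ h : BilinField n M, Real.sqrt (coordGram h (chartAt (RSpace n) x) y).det =
      |A.det| * Real.sqrt (gramAt h ((chartAt (RSpace n) x).symm y)).det := by
    intro h
    rw [hA h, Matrix.det_mul, Matrix.det_mul, Matrix.det_transpose, ← Real.sqrt_sq_eq_abs,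
      ← Real.sqrt_mul (sq_nonneg _)]
    congr 1
    ring
  have hne : Real.sqrt (gramAt g.inner ((chartAt (RSpace n) x).symm y)).det ≠ 0 :=
    (Real.sqrt_pos.2 (gramAt_det_pos g _)).ne'
  rw [hd, hd]
  simp only [absJacobian]
  field_simp

end

/-! Write `Φ^* g = e^{2Υ} g`. Then `|J_Φ| = e^{nΥ}`, so `u · Φ = e^{-wΥ} Φ^* u`, and the chain rule
for `|J_Φ|` makes this a right action. The rest combines two invariances.

Diffeomorphism invariance (`PolyDiffOp.op_pullback`): a universal coordinate formula cannot
distinguish `(M, Φ^* g)` from `(M, g)`, so `D^{Φ^* g}(Φ^* u) = Φ^*(D^g u)`.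

Conformal covariance (`PolyDiffOp.op_conformal`): `D^{e^{2Υ} g}(v) = e^{-(w+n)Υ} D^g(e^{-wΥ} v)`.
Only the Dirichlet form is assumed covariant, with some weight `w₀`. The fundamental lemma of the
calculus of variations gives the pointwise law for compactly supported arguments, and locality
(`PolyDiffOp.op_congr`) extends it to all smooth ones. Constant `Υ` and the homogeneity then force
`w₀ = w` unless `D^g = 0`.

Together, `D^g(u · Φ) = e^{(w+n)Υ} Φ^*(D^g u)`. The right-hand side of the equation scales by the
same factor, since its degree `q` in `u` satisfies `-wq = w + n`. For a constraint `C` the factor is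
also a positive exponential, so signs, and hence the cone, are preserved. -/

/-! ### Locality of complete contractions -/

theorem partialD_congr {n : ℕ} {f f' : RSpace n → ℝ} {y : RSpace n} (h : f =ᶠ[𝓝 y] f')
    (i : Fin n) : partialD i f =ᶠ[𝓝 y] partialD i f' := by
  filter_upwards [h.fderiv (𝕜 := ℝ)] with z hz
  simp only [partialD, hz]

theorem covDeriv_congr {n m : ℕ} (G : RSpace n → Matrix (Fin n) (Fin n) ℝ)
    {T T' : CoordTensor n m} {y : RSpace n} (h : ∀ a, T a =ᶠ[𝓝 y] T' a)
    (a : Fin (m + 1) → Fin n) : covDeriv G T a =ᶠ[𝓝 y] covDeriv G T' a := by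
  filter_upwards [partialD_congr (h (Fin.tail a)) (a 0), Filter.eventually_all.2 h] with z h1 h2
  simp only [covDeriv, h1, h2]

/-- Equality near `y`, not merely at `y`, is what survives the induction, since every further
covariant derivative differentiates again. -/
theorem iterCovDeriv_congr {n m : ℕ} (G : RSpace n → Matrix (Fin n) (Fin n) ℝ)
    {T T' : CoordTensor n m} {y : RSpace n} (h : ∀ a, T a =ᶠ[𝓝 y] T' a) :
    ∀ (N : ℕ) (a : Fin (m + N) → Fin n), iterCovDeriv G T N a =ᶠ[𝓝 y] iterCovDeriv G T' N a
  | 0, a => h a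
  | N + 1, a => covDeriv_congr G (iterCovDeriv_congr G h N) a

theorem CompleteContraction.eval_congr {n ℓ : ℕ} (K : CompleteContraction ℓ)
    (G : RSpace n → Matrix (Fin n) (Fin n) ℝ) {u u' : Fin ℓ → RSpace n → ℝ} {y : RSpace n}
    (h : ∀ j, u j =ᶠ[𝓝 y] u' j) : K.eval G u y = K.eval G u' y := by
  have key : ∀ j a, iterCovDeriv G (fun _ : Fin 0 → Fin n => u j) (K.funOrder j) a y =
      iterCovDeriv G (fun _ : Fin 0 → Fin n => u' j) (K.funOrder j) a y := fun j a =>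
    (iterCovDeriv_congr G (fun _ => h j) (K.funOrder j) a).eq_of_nhds
  simp only [CompleteContraction.eval, key]

/-! ### Diffeomorphism invariance and locality of polydifferential operators -/

section

variable {n ℓ : ℕ} {M : Type u} [TopologicalSpace M] [ChartedSpace (RSpace n) M]

/-- The inverse of the chart `φ ∘ e` is `e⁻¹ ∘ φ⁻¹`, and the differential of `e` in the pullback
cancels that of `e⁻¹` on the coordinate fields. -/
theorem coordGram_diffeo (g : BilinField n M) (e : M ≃ₜ M) (he : ContMDiff (𝓡 n) (𝓡 n) ∞ e)
    (he' : ContMDiff (𝓡 n) (𝓡 n) ∞ e.symm) (φ : OpenPartialHomeomorph M (RSpace n)) :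
    coordGram (pullbackForm e g) (e.transOpenPartialHomeomorph φ) = coordGram g φ := by
  funext y
  have hsymm : ((e.transOpenPartialHomeomorph φ).symm : RSpace n → M) = e.symm ∘ φ.symm := rfl
  have hd : ∀ v : RSpace n, mfderiv (𝓡 n) (𝓡 n) e (e.symm (φ.symm y))
      (mfderiv 𝓘(ℝ, RSpace n) (𝓡 n) (e.symm ∘ φ.symm) y v) =
      mfderiv 𝓘(ℝ, RSpace n) (𝓡 n) φ.symm y v := by
    intro v
    have hφ : (φ.symm : RSpace n → M) = e ∘ (e.symm ∘ φ.symm) := by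
      funext z; simp
    -- Off the target of `φ` differentiability may fail. It then fails for both maps, and both
    -- derivatives take the default value `0`; so the identity holds on all of `ℝⁿ`.
    by_cases h : MDifferentiableAt 𝓘(ℝ, RSpace n) (𝓡 n) (e.symm ∘ φ.symm) y
    · have := mfderiv_comp y ((he.mdifferentiable (by simp)) (e.symm (φ.symm y))) h
      rw [← hφ] at this
      rw [this]
      rfl
    · have h2 : ¬ MDifferentiableAt 𝓘(ℝ, RSpace n) (𝓡 n) φ.symm y := fun h2 =>
        h (((he'.mdifferentiable (by simp)) _).comp y h2)
      rw [mfderiv_zero_of_not_mdifferentiableAt h, mfderiv_zero_of_not_mdifferentiableAt h2]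
      exact map_zero _
  ext i j
  simp only [coordGram, pullbackForm_apply]
  have h1 := hd (EuclideanSpace.single i (1 : ℝ))
  have h2 := hd (EuclideanSpace.single j (1 : ℝ))
  -- The base points `e (e⁻¹ (φ⁻¹ y))` and `φ⁻¹ y` are only propositionally equal, so the forms are
  -- compared on the model space.
  have aux : ∀ (p q : M) (hpq : p = q) (a b : RSpace n),
      (show RSpace n →L[ℝ] RSpace n →L[ℝ] ℝ from g p) a b =
      (show RSpace n →L[ℝ] RSpace n →L[ℝ] ℝ from g q) a b := by
    rintro p q rfl a b; rfl
  refine (aux _ _ (e.apply_symm_apply (φ.symm y)) _ _).trans ?_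
  refine Eq.trans ?_ (congrArg₂ (fun a b => (show RSpace n →L[ℝ] RSpace n →L[ℝ] ℝ from
    g (φ.symm y)) a b) h1 h2)
  rfl

variable [IsManifold (𝓡 n) ∞ M]

theorem transOpenPartialHomeomorph_mem_maximalAtlas (e : M ≃ₜ M)
    (he : ContMDiff (𝓡 n) (𝓡 n) ∞ e) (he' : ContMDiff (𝓡 n) (𝓡 n) ∞ e.symm)
    {φ : OpenPartialHomeomorph M (RSpace n)} (hφ : φ ∈ IsManifold.maximalAtlas (𝓡 n) ∞ M) :
    e.transOpenPartialHomeomorph φ ∈ IsManifold.maximalAtlas (𝓡 n) ∞ M := by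
  rw [IsManifold.mem_maximalAtlas_iff_contMDiffOn] at hφ ⊢
  exact ⟨hφ.1.comp he.contMDiffOn fun _ hx => hx, he'.comp_contMDiffOn hφ.2⟩

/-- The metric `e^{2Υ} g`. -/
noncomputable def conformalMetric (Υ : SmoothFun n M) (g : SmoothMetric n M) : SmoothMetric n M where
  inner x := Real.exp (2 * Υ x) • g.inner x
  symm x v w := congrArg (Real.exp (2 * Υ x) * ·) (g.symm x v w)
  pos x v hv := mul_pos (Real.exp_pos _) (g.pos x v hv)
  isVonNBounded x := by
    -- The unit ball of `e^{2Υ} g` is `e^{-Υ}` times that of `g`.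
    have h := (g.isVonNBounded x).image
      ((Real.exp (-Υ x)) • ContinuousLinearMap.id ℝ (TangentSpace (𝓡 n) x))
    refine Bornology.IsVonNBounded.subset ?_ h
    intro v hv
    refine ⟨Real.exp (Υ x) • v, ?_, ?_⟩
    · have e1 : g.inner x (Real.exp (Υ x) • v) (Real.exp (Υ x) • v) =
          Real.exp (2 * Υ x) * g.inner x v v := by
        rw [map_smul, map_smul, two_mul, Real.exp_add, mul_assoc]
        rfl
      exact e1.trans_lt hv
    · change Real.exp (-Υ x) • Real.exp (Υ x) • v = v
      rw [smul_smul, ← Real.exp_add, neg_add_cancel, Real.exp_zero, one_smul]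
  contMDiff := by
    have hf : ContMDiff (𝓡 n) 𝓘(ℝ, ℝ) ∞ (fun x => Real.exp (2 * Υ x)) :=
      Real.contDiff_exp.contMDiff.comp (contMDiff_const.mul Υ.contMDiff)
    exact hf.smul_section g.contMDiff

theorem isConformalChange_conformalMetric (Υ : SmoothFun n M) (g : SmoothMetric n M) :
    IsConformalChange Υ g.inner (conformalMetric Υ g).inner := fun _ _ _ => rfl

variable [T2Space M] [SecondCountableTopology M]

namespace PolyDiffOp

/-- Polydifferential operators are local. -/
theorem op_congr (D : PolyDiffOp.{u} n ℓ) (g : SmoothMetric n M) {v v' : Fin ℓ → SmoothFun n M}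
    {p : M} (h : ∀ j, v j =ᶠ[𝓝 p] v' j) : D.op M g v p = D.op M g v' p := by
  obtain ⟨c, hc⟩ := D.natural
  have hp := mem_chart_source (RSpace n) p
  have hφ := IsManifold.chart_mem_maximalAtlas (I := 𝓡 n) (n := ∞) p
  have hy := (chartAt (RSpace n) p).map_source hp
  have hpy := (chartAt (RSpace n) p).left_inv hp
  have h1 := hc M g v _ hφ _ hy
  have h2 := hc M g v' _ hφ _ hy
  rw [hpy] at h1 h2
  rw [h1, h2]
  refine Finsupp.sum_congr fun K _ => ?_
  congr 1
  refine K.eval_congr _ fun j => ?_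
  have ht := (chartAt (RSpace n) p).continuousAt_symm hy
  rw [ContinuousAt, hpy] at ht
  exact ht.eventually (h j)

/-- Polydifferential operators are invariant under diffeomorphisms. -/
theorem op_pullback (D : PolyDiffOp.{u} n ℓ) (g ghat : SmoothMetric n M) (e : M ≃ₜ M)
    (he : ContMDiff (𝓡 n) (𝓡 n) ∞ e) (he' : ContMDiff (𝓡 n) (𝓡 n) ∞ e.symm)
    (hg : ghat.inner = pullbackForm e g.inner) (v : Fin ℓ → SmoothFun n M) (x : M) :
    D.op M ghat (fun j => (v j).comp ⟨e, he⟩) x = D.op M g v (e x) := by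
  obtain ⟨c, hc⟩ := D.natural
  have hp := mem_chart_source (RSpace n) (e x)
  have hφ := IsManifold.chart_mem_maximalAtlas (I := 𝓡 n) (n := ∞) (e x)
  have hy := (chartAt (RSpace n) (e x)).map_source hp
  have h1 := hc M g v _ hφ _ hy
  -- In the chart precomposed with `e`, the pulled back metric and functions have the same
  -- coordinate expressions as the originals in the chart at `e x`.
  have h2 := hc M ghat (fun j => (v j).comp ⟨e, he⟩) _
    (transOpenPartialHomeomorph_mem_maximalAtlas e he he' hφ) _ hy
  rw [hg, coordGram_diffeo g.inner e he he'] at h2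
  rw [(chartAt (RSpace n) (e x)).left_inv hp] at h1
  have hsymm : ∀ y, (e.transOpenPartialHomeomorph (chartAt (RSpace n) (e x))).symm y =
      e.symm ((chartAt (RSpace n) (e x)).symm y) := fun _ => rfl
  rw [hsymm, (chartAt (RSpace n) (e x)).left_inv hp, e.symm_apply_apply] at h2
  rw [h1, h2]
  refine Finsupp.sum_congr fun K _ => ?_
  congr 2
  funext j z
  rw [hsymm]
  exact congrArg (v j) (e.apply_symm_apply _)

end PolyDiffOp

end

/-! ### The Riemannian integral and the fundamental lemma of the calculus of variations -/

section

variable {n : ℕ} {M : Type u} [TopologicalSpace M] [ChartedSpace (RSpace n) M]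
  [IsManifold (𝓡 n) ∞ M]

theorem continuousOn_coordGram (g : SmoothMetric n M) {φ : OpenPartialHomeomorph M (RSpace n)}
    (hφ : φ ∈ IsManifold.maximalAtlas (𝓡 n) ∞ M) :
    ContinuousOn (coordGram g.inner φ) φ.target := by
  have hs : ContMDiffOn 𝓘(ℝ, RSpace n) (𝓡 n) ∞ φ.symm φ.target :=
    contMDiffOn_symm_of_mem_maximalAtlas hφ
  have hfield : ∀ e : RSpace n, ContMDiffOn 𝓘(ℝ, RSpace n) (𝓡 n).tangent 0
      (fun y => (Bundle.TotalSpace.mk' (RSpace n) (φ.symm y)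
        (mfderiv 𝓘(ℝ, RSpace n) (𝓡 n) φ.symm y e) : TangentBundle (𝓡 n) M)) φ.target := by
    intro e
    -- A coordinate field is the tangent map of `φ⁻¹` applied to a constant field, hence a
    -- continuous section.
    have h1 := hs.contMDiffOn_tangentMapWithin (m := 0) (by simp)
      φ.open_target.uniqueMDiffOn
    have h2 : ContMDiffOn 𝓘(ℝ, RSpace n) 𝓘(ℝ, RSpace n).tangent 0
        (fun y => (Bundle.TotalSpace.mk' (RSpace n) y e : TangentBundle 𝓘(ℝ, RSpace n) (RSpace n)))
        φ.target := fun y _ =>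
      contMDiffWithinAt_vectorSpace_iff_contDiffWithinAt.2 contDiffWithinAt_const
    refine (h1.comp h2 fun y hy => hy).congr fun y hy => ?_
    simp only [Function.comp_apply, tangentMapWithin]
    rw [mfderivWithin_of_isOpen φ.open_target hy]
  refine continuousOn_pi.2 fun i => continuousOn_pi.2 fun j => ?_
  have h := ContMDiffOn.clm_bundle_apply₂ (F₁ := RSpace n) (F₂ := RSpace n) (F₃ := ℝ)
    (E₁ := fun x : M => TangentSpace (𝓡 n) x) (E₂ := fun x : M => TangentSpace (𝓡 n) x)
    (E₃ := Bundle.Trivial M ℝ) (b := φ.symm) (ψ := fun y => g.inner (φ.symm y))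
    ((g.contMDiff.of_le (by simp)).comp_contMDiffOn (hs.of_le (by simp)))
    (hfield (EuclideanSpace.single i (1 : ℝ))) (hfield (EuclideanSpace.single j (1 : ℝ)))
  intro y hy
  have h3 := h y hy
  rw [Bundle.contMDiffWithinAt_totalSpace] at h3
  exact h3.2.continuousWithinAt

/-- On the target the differential of the inverse chart is injective, so the coordinate fields are
independent and their Gram matrix is positive definite. -/
theorem coordGram_det_pos (g : SmoothMetric n M) (x : M) {y : RSpace n}
    (hy : y ∈ (chartAt (RSpace n) x).target) :
    0 < (coordGram g.inner (chartAt (RSpace n) x) y).det := by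
  set φ := chartAt (RSpace n) x
  let L : RSpace n →L[ℝ] RSpace n := mfderiv 𝓘(ℝ, RSpace n) (𝓡 n) φ.symm y
  have hL : Function.Injective L :=
    (mdifferentiable_chart x).symm.mfderiv_injective hy
  let B : RSpace n →L[ℝ] RSpace n →L[ℝ] ℝ := g.inner (φ.symm y)
  have hB : ∀ v w, B v w = B w v := g.symm (φ.symm y)
  have hpos : ∀ v, v ≠ 0 → 0 < B v v := g.pos (φ.symm y)
  refine Matrix.PosDef.det_pos (Matrix.PosDef.of_dotProduct_mulVec_pos ?_ ?_)
  · ext i j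
    exact hB _ _
  · intro v hv
    have h := hpos (L (∑ a, v a • EuclideanSpace.single a (1 : ℝ))) (by
      intro h0
      apply hv
      have h1 := hL (h0.trans (map_zero L).symm)
      funext b
      have := congrArg (fun z : RSpace n => z b) h1
      simpa [Finset.sum_apply, Pi.single_apply] using this)
    have e : B (L (∑ a, v a • EuclideanSpace.single a (1 : ℝ)))
        (L (∑ a, v a • EuclideanSpace.single a (1 : ℝ))) =
        star v ⬝ᵥ ((coordGram g.inner φ y).mulVec v) := by
      simp only [map_sum, map_smul, _root_.sum_apply,
        _root_.smul_apply, smul_eq_mul, Finset.mul_sum, dotProduct, Matrix.mulVec]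
      rw [Finset.sum_comm]
      refine Finset.sum_congr rfl fun b _ => Finset.sum_congr rfl fun a _ => ?_
      simp only [star_trivial, coordGram]
      change v a * (v b * B _ _) = v b * (B (L _) (L _) * v a)
      ring
    rwa [e] at h

variable [T2Space M] [SecondCountableTopology M]

/-- The integrand of the `x`-th summand of `volIntegral g f`. -/
noncomputable def volIntegrand (g : BilinField n M) (f : M → ℝ) (x : M) (y : RSpace n) : ℝ :=
  chartPartition n M x ((chartAt (RSpace n) x).symm y) * f ((chartAt (RSpace n) x).symm y) *
    Real.sqrt (coordGram g (chartAt (RSpace n) x) y).det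

theorem chartPartition_tsupport_subset (x : M) :
    tsupport (chartPartition n M x) ⊆ (chartAt (RSpace n) x).source :=
  haveI : LocallyCompactSpace M := ChartedSpace.locallyCompactSpace (RSpace n) M
  (SmoothPartitionOfUnity.exists_isSubordinate_chartAt_source (𝓡 n) M).choose_spec x

theorem continuousOn_volIntegrand (g : SmoothMetric n M) {f : M → ℝ} (hf : Continuous f) (x : M) :
    ContinuousOn (volIntegrand g.inner f x) (chartAt (RSpace n) x).target := by
  have hs := (chartAt (RSpace n) x).continuousOn_symm
  exact (((chartPartition n M x).2.continuous.comp_continuousOn hs).mul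
    (hf.comp_continuousOn hs)).mul (Real.continuous_sqrt.comp_continuousOn
      (continuous_id.matrix_det.comp_continuousOn
        (continuousOn_coordGram g (IsManifold.chart_mem_maximalAtlas x))))

/-- The chart domain may be unbounded and the density may blow up at its edge, but the integrand
vanishes off the image of `supp ρ_x ∩ supp f`, a compact subset of the target on which it is
continuous. -/
theorem integrableOn_volIntegrand (g : SmoothMetric n M) {f : M → ℝ} (hf : Continuous f)
    (hc : HasCompactSupport f) (x : M) :
    IntegrableOn (volIntegrand g.inner f x) (chartAt (RSpace n) x).target := by
  set φ := chartAt (RSpace n) x with hφ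
  have hK : IsCompact (tsupport (chartPartition n M x) ∩ tsupport f) :=
    hc.inter_left (isClosed_tsupport _)
  have hsub : tsupport (chartPartition n M x) ∩ tsupport f ⊆ φ.source :=
    inter_subset_left.trans (chartPartition_tsupport_subset x)
  have hK' : IsCompact (φ '' (tsupport (chartPartition n M x) ∩ tsupport f)) :=
    hK.image_of_continuousOn (φ.continuousOn.mono hsub)
  have hsub' : φ '' (tsupport (chartPartition n M x) ∩ tsupport f) ⊆ φ.target := by
    rintro _ ⟨p, hp, rfl⟩
    exact φ.map_source (hsub hp)
  refine (((continuousOn_volIntegrand g hf x).mono hsub').integrableOn_compact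
    hK').of_forall_sdiff_eq_zero φ.open_target.measurableSet ?_
  rintro y ⟨hy, hyK⟩
  by_contra hne
  refine hyK ⟨φ.symm y, ⟨subset_tsupport _ ?_, subset_tsupport _ ?_⟩, φ.right_inv hy⟩
  · exact fun h0 => hne (by simp only [volIntegrand, ← hφ, h0, zero_mul])
  · exact fun h0 => hne (by simp only [volIntegrand, ← hφ, h0, zero_mul, mul_zero])

/-- A compact set meets the supports of only finitely many members of the partition. This keeps the
`finsum` in `volIntegral` from taking its default value `0`. -/
theorem finite_support_volIntegrand (g : BilinField n M) {f : M → ℝ} (hc : HasCompactSupport f) :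
    (Function.support fun x => ∫ y in (chartAt (RSpace n) x).target,
      volIntegrand g f x y).Finite := by
  refine ((chartPartition n M).locallyFinite.finite_nonempty_inter_compact hc).subset
    fun x hx => ?_
  by_contra hne
  refine hx ?_
  have : ∀ y, volIntegrand g f x y = 0 := by
    intro y
    by_contra h0
    refine hne ⟨(chartAt (RSpace n) x).symm y, fun h => h0 ?_, subset_tsupport _ fun h => h0 ?_⟩
    · simp only [volIntegrand, h, zero_mul]
    · simp only [volIntegrand, h, zero_mul, mul_zero]
  simp only [this, integral_zero]

theorem volIntegral_sub (g : SmoothMetric n M) {f₁ f₂ : M → ℝ} (h₁ : Continuous f₁)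
    (hc₁ : HasCompactSupport f₁) (h₂ : Continuous f₂) (hc₂ : HasCompactSupport f₂) :
    volIntegral g.inner (fun x => f₁ x - f₂ x) =
      volIntegral g.inner f₁ - volIntegral g.inner f₂ := by
  refine Eq.trans ?_ (finsum_sub_distrib (finite_support_volIntegrand g.inner hc₁)
    (finite_support_volIntegrand g.inner hc₂))
  refine finsum_congr fun x => ?_
  refine Eq.trans ?_ (integral_sub (integrableOn_volIntegrand g h₁ hc₁ x)
    (integrableOn_volIntegrand g h₂ hc₂ x))
  congr 1
  funext y
  ring

theorem volIntegral_pos (g : SmoothMetric n M) {f : M → ℝ} (hf : Continuous f)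
    (hc : HasCompactSupport f) (h0 : ∀ x, 0 ≤ f x) {p : M} (hp : 0 < f p) :
    0 < volIntegral g.inner f := by
  have hnn : ∀ x y, 0 ≤ volIntegrand g.inner f x y := fun x y =>
    mul_nonneg (mul_nonneg ((chartPartition n M).nonneg _ _) (h0 _)) (Real.sqrt_nonneg _)
  refine finsum_pos (fun x => integral_nonneg (hnn x)) ?_
    (finite_support_volIntegrand g.inner hc)
  -- Some member of the partition is positive at `p`; its integrand is positive on a nonempty open
  -- set, which has positive measure.
  obtain ⟨x, hx⟩ := (chartPartition n M).exists_pos_of_mem (mem_univ p)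
  refine ⟨x, ?_⟩
  have hps : p ∈ (chartAt (RSpace n) x).source :=
    chartPartition_tsupport_subset x (subset_tsupport _ hx.ne')
  refine (setIntegral_pos_iff_support_of_nonneg_ae (Eventually.of_forall (hnn x))
    (integrableOn_volIntegrand g hf hc x)).2 ?_
  have hopen : IsOpen ((chartAt (RSpace n) x).target ∩
      volIntegrand g.inner f x ⁻¹' Ioi 0) :=
    (continuousOn_volIntegrand g hf x).isOpen_inter_preimage
      (chartAt (RSpace n) x).open_target isOpen_Ioi
  refine (hopen.measure_pos volume ⟨chartAt (RSpace n) x p, ?_, ?_⟩).trans_le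
    (measure_mono fun y hy => ⟨ne_of_gt hy.2, hy.1⟩)
  · exact (chartAt (RSpace n) x).map_source hps
  · have hd := coordGram_det_pos g x ((chartAt (RSpace n) x).map_source hps)
    simp only [mem_preimage, mem_Ioi, volIntegrand]
    rw [(chartAt (RSpace n) x).left_inv hps]
    exact mul_pos (mul_pos hx hp) (Real.sqrt_pos.2 hd)

omit [SecondCountableTopology M] in
/-- A compactly supported smooth function that is `1` near `p`. -/
theorem exists_smooth_cutoff (p : M) : ∃ χ : SmoothFun n M, HasCompactSupport χ ∧
    (∀ x, 0 ≤ χ x) ∧ χ =ᶠ[𝓝 p] 1 :=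
  let χ : SmoothBumpFunction (𝓡 n) p := Classical.arbitrary _
  ⟨⟨χ, χ.contMDiff⟩, χ.hasCompactSupport, fun _ => χ.nonneg, χ.eventuallyEq_one⟩

/-- The fundamental lemma of the calculus of variations. -/
theorem eq_of_volIntegral_mul_eq (g : SmoothMetric n M) (F H : SmoothFun n M)
    (h : ∀ v : SmoothFun n M, HasCompactSupport v →
      volIntegral g.inner (fun x => v x * F x) = volIntegral g.inner (fun x => v x * H x)) :
    F = H := by
  ext p
  by_contra hne
  obtain ⟨χ, hc, h0, h1⟩ := exists_smooth_cutoff (n := n) p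
  -- Testing with `χ (F - H)` turns the difference of the two integrals into that of `χ (F - H)²`.
  obtain ⟨v, hv⟩ : ∃ v : SmoothFun n M, ∀ x, v x = χ x * (F x - H x) :=
    ⟨χ * (F - H), fun _ => rfl⟩
  have hF : Continuous F := F.contMDiff.continuous
  have hH : Continuous H := H.contMDiff.continuous
  have hχ : Continuous χ := χ.contMDiff.continuous
  have hcv : HasCompactSupport v := by
    have : (v : M → ℝ) = fun x => χ x * (F x - H x) := funext hv
    rw [this]
    exact hc.mul_right
  have hvc : Continuous v := v.contMDiff.continuous
  have e := volIntegral_sub g (hvc.mul hF) hcv.mul_right (hvc.mul hH) hcv.mul_right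
  have e0 : volIntegral g.inner (v * F) = volIntegral g.inner (v * H) := h v hcv
  rw [e0, sub_self] at e
  have e2 : (fun x => (v * F : M → ℝ) x - (v * H : M → ℝ) x) =
      fun x => χ x * (F x - H x) ^ 2 := by
    funext x
    simp only [Pi.mul_apply, hv]
    ring
  rw [e2] at e
  have hfc : Continuous fun x => χ x * (F x - H x) ^ 2 := hχ.mul ((hF.sub hH).pow 2)
  have hfs : HasCompactSupport fun x => χ x * (F x - H x) ^ 2 := hc.mul_right
  have hpos : 0 < χ p * (F p - H p) ^ 2 := by
    have h2 : χ p = 1 := h1.eq_of_nhds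
    rw [h2, one_mul]
    exact sq_pos_of_ne_zero (sub_ne_zero.2 hne)
  exact (volIntegral_pos g hfc hfs (fun x => mul_nonneg (h0 x) (sq_nonneg _)) hpos).ne' e

end

/-! ### From covariance of the Dirichlet form to pointwise covariance -/

section

variable {n ℓ : ℕ} {M : Type u} [TopologicalSpace M] [ChartedSpace (RSpace n) M]

theorem expMul_apply (a : ℝ) (Υ v : SmoothFun n M) (x : M) :
    expMul a Υ v x = Real.exp (a * Υ x) * v x := rfl

theorem expMul_expMul (a b : ℝ) (Υ v : SmoothFun n M) :
    expMul a Υ (expMul b Υ v) = expMul (a + b) Υ v := by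
  ext x
  simp only [expMul_apply, ← mul_assoc, ← Real.exp_add, add_mul]

theorem expMul_zero (Υ v : SmoothFun n M) : expMul 0 Υ v = v := by
  ext x
  simp only [expMul_apply, zero_mul, Real.exp_zero, one_mul]

theorem sqrt_det_exp_smul (a : ℝ) (A : Matrix (Fin n) (Fin n) ℝ) :
    Real.sqrt (Real.exp (2 * a) • A).det = Real.exp (n * a) * Real.sqrt A.det := by
  have h : Real.exp (2 * a) ^ n = Real.exp (n * a) ^ 2 := by
    rw [← Real.exp_nat_mul, ← Real.exp_nat_mul]
    congr 1
    push_cast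
    ring
  rw [Matrix.det_smul, Fintype.card_fin, h, Real.sqrt_mul (sq_nonneg _),
    Real.sqrt_sq (Real.exp_pos _).le]

theorem IsConformalChange.absJacobian_eq [IsManifold (𝓡 n) ∞ M] {g : SmoothMetric n M}
    {Υ : SmoothFun n M} {Φ : M → M} (h : IsConformalChange Υ g.inner (pullbackForm Φ g.inner))
    (x : M) : absJacobian g.inner Φ x = Real.exp (n * Υ x) := by
  have e : gramAt (pullbackForm Φ g.inner) x = Real.exp (2 * Υ x) • gramAt g.inner x := by
    ext i j
    exact h x _ _
  rw [absJacobian, e, sqrt_det_exp_smul]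
  exact mul_div_cancel_right₀ _ (Real.sqrt_pos.2 (gramAt_det_pos g x)).ne'

theorem IsConformalChange.comp {g : BilinField n M} {A B : SmoothFun n M} {Φ Ψ : M → M}
    (hΦ : ContMDiff (𝓡 n) (𝓡 n) ∞ Φ) (hΨ : ContMDiff (𝓡 n) (𝓡 n) ∞ Ψ)
    (hA : IsConformalChange A g (pullbackForm Φ g))
    (hB : IsConformalChange B g (pullbackForm Ψ g)) :
    IsConformalChange (A.comp ⟨Ψ, hΨ⟩ + B) g (pullbackForm (Φ ∘ Ψ) g) := by
  intro x v w
  rw [pullbackForm_comp hΦ hΨ]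
  have h1 : pullbackForm Ψ (pullbackForm Φ g) x v w =
      Real.exp (2 * A (Ψ x)) * pullbackForm Ψ g x v w :=
    hA (Ψ x) (mfderiv (𝓡 n) (𝓡 n) Ψ x v) (mfderiv (𝓡 n) (𝓡 n) Ψ x w)
  rw [h1, hB x v w, ← mul_assoc, ← Real.exp_add, ← mul_add]
  rfl

variable [IsManifold (𝓡 n) ∞ M] [T2Space M] [SecondCountableTopology M]

theorem IsConformalChange.volIntegral_eq {g ghat : BilinField n M} {Υ : SmoothFun n M}
    (h : IsConformalChange Υ g ghat) (f : M → ℝ) :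
    volIntegral ghat f = volIntegral g (fun x => Real.exp (n * Υ x) * f x) := by
  unfold volIntegral
  refine finsum_congr fun x => ?_
  congr 1
  funext y
  have e : coordGram ghat (chartAt (RSpace n) x) y =
      Real.exp (2 * Υ ((chartAt (RSpace n) x).symm y)) • coordGram g (chartAt (RSpace n) x) y := by
    ext i j
    exact h _ _ _
  rw [e, sqrt_det_exp_smul]
  ring

namespace PolyDiffOp

/-- The Dirichlet form of `D` on `M` has conformal weight `w`. -/
def HasDirichletWeight (D : PolyDiffOp.{u} n ℓ) (M : Type u) [TopologicalSpace M]
    [ChartedSpace (RSpace n) M] [IsManifold (𝓡 n) ∞ M] [T2Space M] [SecondCountableTopology M]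
    (w : ℝ) : Prop :=
  ∀ (g ghat : SmoothMetric n M) (Υ : SmoothFun n M), IsConformalChange Υ g.inner ghat.inner →
    ∀ v : Fin (ℓ + 1) → SmoothFun n M, (∀ j, HasCompactSupport (v j)) →
      D.dirichletForm M ghat (fun j => expMul w Υ (v j)) = D.dirichletForm M g v

variable {D : PolyDiffOp.{u} n ℓ} {g ghat : SmoothMetric n M} {Υ : SmoothFun n M} {w : ℝ}

/-- Under `g ↦ e^{2Υ} g` the volume contributes `e^{nΥ}` and the test function in the first slot
`e^{wΥ}`. The test function being arbitrary, the factor `e^{(w+n)Υ}` can be read off pointwise. -/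
theorem HasDirichletWeight.op_eq_of_hasCompactSupport (hD : D.HasDirichletWeight M w)
    (h : IsConformalChange Υ g.inner ghat.inner) (v : Fin ℓ → SmoothFun n M)
    (hv : ∀ j, HasCompactSupport (v j)) :
    D.op M ghat (fun j => expMul w Υ (v j)) = expMul (-(w + n)) Υ (D.op M g v) := by
  have key : expMul (w + n) Υ (D.op M ghat (fun j => expMul w Υ (v j))) = D.op M g v := by
    refine eq_of_volIntegral_mul_eq g _ _ fun v₀ hv₀ => ?_
    have e := hD g ghat Υ h (Fin.cons v₀ v) (Fin.cases hv₀ hv)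
    simp only [dirichletForm] at e
    rw [h.volIntegral_eq] at e
    refine Eq.trans (congrArg _ ?_) e
    funext x
    change v₀ x * (Real.exp ((w + n) * Υ x) * D.op M ghat (fun j => expMul w Υ (v j)) x) =
      Real.exp (n * Υ x) * (Real.exp (w * Υ x) * v₀ x *
        D.op M ghat (fun j => expMul w Υ (v j)) x)
    rw [add_mul, Real.exp_add]
    ring
  rw [← key, expMul_expMul, neg_add_cancel, expMul_zero]

/-- By locality the arguments may be multiplied by a cutoff equal to `1` near the point considered.
-/
theorem HasDirichletWeight.op_eq (hD : D.HasDirichletWeight M w)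
    (h : IsConformalChange Υ g.inner ghat.inner) (v : Fin ℓ → SmoothFun n M) :
    D.op M ghat (fun j => expMul w Υ (v j)) = expMul (-(w + n)) Υ (D.op M g v) := by
  ext p
  obtain ⟨χ, hc, -, h1⟩ := exists_smooth_cutoff (n := n) p
  have hχ : ∀ j, (χ * v j : SmoothFun n M) =ᶠ[𝓝 p] v j := fun j => by
    filter_upwards [h1] with x hx
    change χ x * v j x = v j x
    rw [hx, Pi.one_apply, one_mul]
  have e := congrArg (fun F : SmoothFun n M => F p)
    (hD.op_eq_of_hasCompactSupport h (fun j => χ * v j) fun j => hc.mul_right)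
  simp only [expMul_apply] at e ⊢
  rw [D.op_congr g hχ] at e
  rw [← e]
  refine (D.op_congr ghat fun j => ?_).symm
  filter_upwards [hχ j] with x hx
  rw [expMul_apply, expMul_apply, hx]

/-- The homogeneity of a nonzero operator determines the weight of its Dirichlet form. -/
theorem HasDirichletWeight.eq_zero_or_weight_eq (hD : D.HasDirichletWeight M w) {k : ℕ}
    (hh : D.HasHomogeneity (-2 * (k : ℝ))) (g : SmoothMetric n M) :
    D.op M g = 0 ∨ w = -(((n : ℝ) - 2 * k) / ((ℓ : ℝ) + 1)) := by
  by_contra hne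
  push Not at hne
  obtain ⟨h0, hw⟩ := hne
  refine h0 (MultilinearMap.ext fun v => ?_)
  ext x
  by_contra hx
  -- With `Υ = 1` the conformal metric is `e² g`, so homogeneity with `c = e` applies. Comparing
  -- factors at a nonzero value gives `ℓw - 2k = -(w + n)`.
  obtain ⟨Υ, hΥ⟩ : ∃ Υ : SmoothFun n M, ∀ x, Υ x = 1 := ⟨1, fun _ => rfl⟩
  have e := congrArg (fun F : SmoothFun n M => F x)
    (hD.op_eq (isConformalChange_conformalMetric Υ g) v)
  have e1 : ∀ j, expMul w Υ (v j) = Real.exp w • v j := fun j => by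
    ext y
    change Real.exp (w * Υ y) * v j y = Real.exp w * v j y
    rw [hΥ, mul_one]
  have e2 := hh M g (conformalMetric Υ g) (Real.exp 1) (Real.exp_pos 1) fun y a b => by
    rw [isConformalChange_conformalMetric Υ g y a b, hΥ, two_mul, Real.exp_add, sq]
  simp only [e1] at e
  rw [MultilinearMap.map_smul_univ, e2] at e
  have e3 : (∏ _j : Fin ℓ, Real.exp w) * (Real.exp 1 ^ (-2 * (k : ℝ)) * D.op M g v x) =
      Real.exp (-(w + n) * Υ x) * D.op M g v x := e
  rw [Finset.prod_const, Finset.card_univ, Fintype.card_fin, ← Real.exp_nat_mul, Real.exp_one_rpow,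
    ← mul_assoc, ← Real.exp_add, hΥ, mul_one] at e3
  have e4 := Real.exp_injective (mul_right_cancel₀ hx e3)
  have hl : (ℓ : ℝ) + 1 ≠ 0 := by positivity
  apply hw
  rw [← neg_div, eq_div_iff hl]
  linarith

/-- Covariance provides some weight `w₀`. It is `w` unless `D^g = 0`; in that case covariance with
`w₀` makes `D^ĝ` vanish too, and the law holds trivially. -/
theorem op_conformal {k : ℕ} (hc : D.IsDirichletCovariant) (hh : D.HasHomogeneity (-2 * (k : ℝ)))
    (hw : w = -(((n : ℝ) - 2 * k) / ((ℓ : ℝ) + 1)))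
    (h : IsConformalChange Υ g.inner ghat.inner) (v : Fin ℓ → SmoothFun n M) :
    D.op M ghat v = expMul (-(w + n)) Υ (D.op M g (fun j => expMul (-w) Υ (v j))) := by
  obtain ⟨w₀, hw₀⟩ := hc
  have hD : D.HasDirichletWeight M w₀ := hw₀ M
  have hinv : ∀ a : ℝ, (fun j => expMul a Υ (expMul (-a) Υ (v j))) = v := fun a => by
    funext j
    rw [expMul_expMul, add_neg_cancel, expMul_zero]
  have e := hD.op_eq h (fun j => expMul (-w₀) Υ (v j))
  rw [hinv] at e
  rcases hD.eq_zero_or_weight_eq hh g with h0 | h0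
  · rw [e, h0]
    ext x
    simp only [expMul_apply, _root_.zero_apply]
    change _ * (0 : ℝ) = _ * (0 : ℝ)
    rw [mul_zero, mul_zero]
  · rw [hw, ← h0]
    exact e

end PolyDiffOp

end

/-! ### The right action of the conformal group -/

namespace conformalGroup

variable {n : ℕ} {M : Type u} [TopologicalSpace M] [ChartedSpace (RSpace n) M]
  [IsManifold (𝓡 n) ∞ M] {g : SmoothMetric n M}

/-- The homeomorphism underlying a conformal diffeomorphism. -/
def toHomeomorph (Φ : conformalGroup g) : M ≃ₜ M where
  toEquiv := Φ
  continuous_toFun := Φ.2.1.continuous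
  continuous_invFun := Φ.2.2.1.continuous

/-- The function `Υ` with `Φ^* g = e^{2Υ} g`. -/
noncomputable def logFactor (Φ : conformalGroup g) : SmoothFun n M := Φ.2.2.2.choose

theorem isConformalChange (Φ : conformalGroup g) :
    IsConformalChange (logFactor Φ) g.inner (pullbackForm (Φ : Equiv.Perm M) g.inner) :=
  Φ.2.2.2.choose_spec

theorem conformalMetric_inner (Φ : conformalGroup g) :
    (conformalMetric (logFactor Φ) g).inner = pullbackForm (toHomeomorph Φ) g.inner := by
  funext x
  ext v w
  exact (isConformalChange Φ x v w).symm

/-- The function `|J_Φ|^{-w/n} Φ^* v`, see `pullback_apply`. -/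
noncomputable def pullback (w : ℝ) (Φ : conformalGroup g) (v : SmoothFun n M) : SmoothFun n M :=
  expMul (-w) (logFactor Φ) (v.comp ⟨toHomeomorph Φ, Φ.2.1⟩)

theorem absJacobian_rpow (hn : n ≠ 0) (w : ℝ) (Φ : conformalGroup g) (x : M) :
    absJacobian g.inner (Φ : Equiv.Perm M) x ^ (-w / n) = Real.exp (-w * logFactor Φ x) := by
  have hn' : (n : ℝ) ≠ 0 := Nat.cast_ne_zero.2 hn
  rw [(isConformalChange Φ).absJacobian_eq, ← Real.exp_mul]
  congr 1
  field_simp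

theorem pullback_apply (hn : n ≠ 0) (w : ℝ) (Φ : conformalGroup g) (v : SmoothFun n M) (x : M) :
    pullback w Φ v x = absJacobian g.inner (Φ : Equiv.Perm M) x ^ (-w / n) *
      v ((Φ : Equiv.Perm M) x) := by
  rw [absJacobian_rpow hn]
  rfl

theorem absJacobian_one (x : M) :
    absJacobian g.inner ((1 : conformalGroup g) : Equiv.Perm M) x = 1 := by
  have : pullbackForm (((1 : conformalGroup g) : Equiv.Perm M) : M → M) g.inner = g.inner :=
    pullbackForm_id g.inner
  rw [absJacobian, this]
  exact div_self (Real.sqrt_pos.2 (gramAt_det_pos g x)).ne'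

/-- `(Φ ∘ Ψ)^* g` has logarithmic factor `Υ_Φ ∘ Ψ + Υ_Ψ`. Any logarithmic factor computes the
Jacobian, so the chosen `logFactor` need not be additive. -/
theorem absJacobian_mul (Φ Ψ : conformalGroup g) (x : M) :
    absJacobian g.inner ((Φ * Ψ : conformalGroup g) : Equiv.Perm M) x =
      absJacobian g.inner (Φ : Equiv.Perm M) ((Ψ : Equiv.Perm M) x) *
        absJacobian g.inner (Ψ : Equiv.Perm M) x := by
  have h := ((isConformalChange Φ).comp Φ.2.1 Ψ.2.1 (isConformalChange Ψ)).absJacobian_eq x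
  rw [(isConformalChange Φ).absJacobian_eq, (isConformalChange Ψ).absJacobian_eq,
    ← Real.exp_add, ← mul_add]
  exact h

theorem absJacobian_pos (Φ : conformalGroup g) (x : M) :
    0 < absJacobian g.inner (Φ : Equiv.Perm M) x := by
  rw [(isConformalChange Φ).absJacobian_eq]
  exact Real.exp_pos _

/-- The right action `v · Φ = |J_Φ|^{-w/n} Φ^* v` of the conformal group. -/
noncomputable abbrev mulAction (hn : n ≠ 0) (w : ℝ) (g : SmoothMetric n M) :
    MulAction (conformalGroup g)ᵐᵒᵖ (SmoothFun n M) where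
  smul Φ v := pullback w Φ.unop v
  one_smul v := by
    ext x
    refine (pullback_apply hn w 1 v x).trans ?_
    rw [absJacobian_one, Real.one_rpow, one_mul]
    rfl
  mul_smul Φ Ψ v := by
    ext x
    -- The opposite group reverses the product, so the cocycle identity is used for `Ψ ∘ Φ`.
    refine (pullback_apply hn w (Ψ.unop * Φ.unop) v x).trans ?_
    refine Eq.trans ?_ (pullback_apply hn w Φ.unop (pullback w Ψ.unop v) x).symm
    rw [pullback_apply hn, absJacobian_mul,
      Real.mul_rpow (absJacobian_pos _ _).le (absJacobian_pos _ _).le,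
      mul_comm (_ ^ _) (_ ^ _), mul_assoc]
    rfl

variable [T2Space M] [SecondCountableTopology M]

theorem op_conformalMetric {ℓ : ℕ} (D : PolyDiffOp.{u} n ℓ) (Φ : conformalGroup g)
    (v : Fin ℓ → SmoothFun n M) (x : M) :
    D.op M (conformalMetric (logFactor Φ) g)
        (fun j => (v j).comp ⟨toHomeomorph Φ, Φ.2.1⟩) x = D.op M g v ((Φ : Equiv.Perm M) x) :=
  D.op_pullback g _ (toHomeomorph Φ) Φ.2.1 Φ.2.2.1 (conformalMetric_inner Φ) v x

end conformalGroup

/-! ### Invariance of the cone and of the equation -/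

namespace ConstrainedOp

open conformalGroup

variable {n ℓ k : ℕ} {M : Type u} [TopologicalSpace M] [ChartedSpace (RSpace n) M]
  [IsManifold (𝓡 n) ∞ M] [T2Space M] [SecondCountableTopology M] {g : SmoothMetric n M} {w : ℝ}

/-- The weight `-w` of a constraint is the one in `u · Φ`, so `C^g(u · Φ)` at `x` is a positive
multiple of `C^g(u)` at `Φ x`. Surjectivity of `Φ` then gives both directions. -/
theorem pullback_mem_cone_iff (P : ConstrainedOp.{u} n ℓ k)
    (hw : w = -(((n : ℝ) - 2 * k) / ((ℓ : ℝ) + 1))) (Φ : conformalGroup g) (v : SmoothFun n M) :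
    pullback w Φ v ∈ P.cone g ↔ v ∈ P.cone g := by
  have key : ∀ C ∈ P.constraints, ∀ x : M, 0 < C.2.op M g (fun _ => pullback w Φ v) x ↔
      0 < C.2.op M g (fun _ => v) ((Φ : Equiv.Perm M) x) := by
    intro C hC x
    obtain ⟨b, hb⟩ := P.constraint_weight C hC
    have e := hb M g _ _ (isConformalChange_conformalMetric (logFactor Φ) g)
      (v.comp ⟨toHomeomorph Φ, Φ.2.1⟩)
    rw [← op_conformalMetric C.2 Φ (fun _ => v) x, e, expMul_apply,
      mul_pos_iff_of_pos_left (Real.exp_pos _), pullback, hw, neg_neg]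
  refine forall₂_congr fun C hC => ?_
  rw [forall_congr' (key C hC)]
  exact ((Φ : Equiv.Perm M).surjective.forall (p := fun y => 0 < C.2.op M g (fun _ => v) y)).symm

theorem solves_pullback {P : ConstrainedOp.{u} n ℓ k} (hk : 2 * k < n)
    (hw : w = -(((n : ℝ) - 2 * k) / ((ℓ : ℝ) + 1))) {lam : ℝ} {v : SmoothFun n M}
    (hv : P.Solves g lam v) (Φ : conformalGroup g) : P.Solves g lam (pullback w Φ v) := by
  intro x
  have e := congrArg (fun F : SmoothFun n M => F x)
    (PolyDiffOp.op_conformal P.covariant P.homogeneity hw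
      (isConformalChange_conformalMetric (logFactor Φ) g)
      (fun _ => v.comp ⟨toHomeomorph Φ, Φ.2.1⟩))
  simp only [expMul_apply] at e
  rw [op_conformalMetric P.D Φ (fun _ => v) x, hv] at e
  have hpull : pullback w Φ v x =
      Real.exp (-w * logFactor Φ x) * v ((Φ : Equiv.Perm M) x) := rfl
  set a := logFactor Φ x
  set t := v ((Φ : Equiv.Perm M) x)
  have hD : P.D.op M g (fun _ => conformalGroup.pullback w Φ v) x =
      Real.exp ((w + n) * a) * ((((n : ℝ) - 2 * k) / ((ℓ : ℝ) + 1)) ^ ℓ * lam *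
        |t| ^ (((((ℓ : ℝ) + 1) - 2) * n + 4 * k) / ((n : ℝ) - 2 * k)) * t) := by
    rw [e, ← mul_assoc, ← Real.exp_add, neg_mul, add_neg_cancel, Real.exp_zero, one_mul]
    rfl
  have hd : (n : ℝ) - 2 * k ≠ 0 := by
    have : (2 * k : ℝ) < n := by exact_mod_cast hk
    linarith
  have hl : (ℓ : ℝ) + 1 ≠ 0 := by positivity
  -- With `p` the exponent of `|u|`, this is `w + n = -w (p + 1)`: the nonlinearity has exactly the
  -- conformally critical degree.
  have hexp : (w + n) * a =
      -w * a * (((((ℓ : ℝ) + 1) - 2) * n + 4 * k) / ((n : ℝ) - 2 * k)) + -w * a := by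
    rw [hw]
    field_simp
    ring
  -- Splitting the power needs only nonnegative bases, so `t = 0` is no special case.
  rw [hD, hpull, abs_mul, Real.abs_exp, Real.mul_rpow (Real.exp_pos _).le (abs_nonneg _),
    ← Real.exp_mul, hexp, Real.exp_add]
  ring

end ConstrainedOp

theorem lemma1p4 (n ℓ k : ℕ) (hk : 2 * k < n) (P : ConstrainedOp.{u} n ℓ k)
    (M : Type u) [TopologicalSpace M] [ChartedSpace (RSpace n) M] [IsManifold (𝓡 n) ∞ M]
    [T2Space M] [SecondCountableTopology M] (g : SmoothMetric n M)
    (w : ℝ) (hw : w = -(((n : ℝ) - 2 * k) / ((ℓ : ℝ) + 1))) :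
    ∃ _ : MulAction (conformalGroup g)ᵐᵒᵖ (SmoothFun n M),
      (∀ (Φ : conformalGroup g) (v : SmoothFun n M) (x : M),
        (MulOpposite.op Φ • v) x =
          absJacobian g.inner (Φ : Equiv.Perm M) x ^ (-w / n) * v ((Φ : Equiv.Perm M) x)) ∧
      (∀ (Φ : conformalGroup g) (v : SmoothFun n M),
        MulOpposite.op Φ • v ∈ P.cone g ↔ v ∈ P.cone g) ∧
      (∀ (Φ : conformalGroup g) (lam : ℝ) (v : SmoothFun n M), v ∈ P.cone g →
        P.Solves g lam v → P.Solves g lam (MulOpposite.op Φ • v)) :=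
  have hn : n ≠ 0 := by omega
  ⟨conformalGroup.mulAction hn w g, fun Φ v x => conformalGroup.pullback_apply hn w Φ v x,
    fun Φ v => P.pullback_mem_cone_iff hw Φ v, fun Φ _ _ _ hv => ConstrainedOp.solves_pullback hk hw hv Φ⟩
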